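/- Let $d\ge 1$ and let $\Omega\subset\mathbb{R}^d$ be a bounded domain (a nonempty, connected, bounded open set). A \emph{Dirichlet eigenfunction} of $\Omega$ with eigenvalue $\lambda\in\mathbb{R}$ is a nonzero real function $u\in H^1_0(\Omega)$ (the closure of $C_c^\infty(\Omega)$ in $H^1(\Omega)$) with $-\Delta u=\lambda u$ weakly, that is, $\int_\Omega\nabla u\cdot\nabla\psi\,dx=\lambda\int_\Omega u\,\psi\,dx$ for all $\psi\in C_c^\infty(\Omega)$. Then there is an $L^2(\Omega)$-orthonormal sequence $(\phi_k)_{k\in\mathbb{N}}$ of Dirichlet eigenfunctions, with eigenvalues $(\lambda_k)_{k\in\mathbb{N}}$, that lists all of them with multiplicity: every Dirichlet eigenfunction with eigenvalue $\lambda$ is a finite linear combination of those $\phi_k$ with $\lambda_k=\lambda$. Moreover, for every such sequence (in whatever order, and however the bases of the eigenspaces are chosen), infinitely many of the $\phi_k$ have nonzero mean value: the set $$\Big\{k\in\mathbb{N} : \frac{1}{|\Omega|}\int_\Omega \phi_k(x)\,dx\neq 0\Big\}$$ is infinite. -/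

import Mathlib

open MeasureTheory Filter Topology TopologicalSpace
open scoped Distributions Gradient

/-- `u` belongs to `H¹₀(Ω)` and `g` is its weak gradient: `(u, g)` is the limit in
`L²(Ω) × L²(Ω; ℝᵈ)` of pairs `(ψ, ∇ψ)` with `ψ` a smooth function compactly supported in `Ω`. -/
def HasDirichletGradient {d : ℕ} (Ω : Opens (EuclideanSpace ℝ (Fin d)))
    (u : Lp ℝ 2 (volume.restrict (Ω : Set (EuclideanSpace ℝ (Fin d)))))
    (g : Lp (EuclideanSpace ℝ (Fin d)) 2
      (volume.restrict (Ω : Set (EuclideanSpace ℝ (Fin d))))) : Prop :=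
  ∃ ψ : ℕ → 𝓓(Ω, ℝ),
    Tendsto (fun n => eLpNorm (fun x => ψ n x - u x) 2
      (volume.restrict (Ω : Set (EuclideanSpace ℝ (Fin d))))) atTop (𝓝 0) ∧
    Tendsto (fun n => eLpNorm (fun x => ∇ (ψ n) x - g x) 2
      (volume.restrict (Ω : Set (EuclideanSpace ℝ (Fin d))))) atTop (𝓝 0)

/-- `u` is a Dirichlet eigenfunction of the Laplacian on `Ω` with eigenvalue `ev`: a nonzero
element of `H¹₀(Ω)` with `-Δu = ev • u` weakly in `Ω`. -/
def IsDirichletEigenfunction {d : ℕ} (Ω : Opens (EuclideanSpace ℝ (Fin d))) (ev : ℝ)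
    (u : Lp ℝ 2 (volume.restrict (Ω : Set (EuclideanSpace ℝ (Fin d))))) : Prop :=
  u ≠ 0 ∧ ∃ g, HasDirichletGradient Ω u g ∧
    ∀ ψ : 𝓓(Ω, ℝ), ∫ x in Ω, inner ℝ (g x) (∇ ψ x) = ev * ∫ x in Ω, u x * ψ x

/-- `φ` is an `L²(Ω)`-orthonormal sequence of Dirichlet eigenfunctions with eigenvalues `ev` that
lists all Dirichlet eigenfunctions with multiplicity: every eigenfunction is a finite linear
combination of those `φ k` that have the same eigenvalue. The order of the list is arbitrary. -/
structure IsDirichletEigensequence {d : ℕ} (Ω : Opens (EuclideanSpace ℝ (Fin d)))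
    (ev : ℕ → ℝ)
    (φ : ℕ → Lp ℝ 2 (volume.restrict (Ω : Set (EuclideanSpace ℝ (Fin d))))) : Prop where
  orthonormal : Orthonormal ℝ φ
  eigenfunction : ∀ k, IsDirichletEigenfunction Ω (ev k) (φ k)
  exhaustive : ∀ μ u, IsDirichletEigenfunction Ω μ u →
    u ∈ Submodule.span ℝ (φ '' {k | ev k = μ})

/-! Finite linear combinations of eigenfunctions lie in H¹₀(Ω), but the constant function 1 does
not. If only finitely many `φ k` had nonzero integral, then 1 would have only finitely many nonzero
coefficients ⟨`φ k`, 1⟩ in a complete orthonormal system, hence would be a finite combination of the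
`φ k` (`Orthonormal.mem_span_of_finite`), a contradiction. This needs completeness of the
eigenfunctions and 1 ∉ H¹₀(Ω).

Completeness comes from the spectral theorem. Let J : H¹₀(Ω) → L²(Ω) be the inclusion, H¹₀ carrying
the H¹ inner product. Then T = J J† is (1 - Δ)⁻¹, and its eigenvectors with eigenvalue (1 + λ)⁻¹ are
exactly the Dirichlet eigenfunctions with eigenvalue λ (`isDirichletEigenfunction_iff`). T is
symmetric, injective, and compact by Rellich's theorem. For the latter, averaging a test function
over the cells of a grid of mesh 1/n costs O(1/n) times the L² norm of its gradient
(`lintegral_sub_gridAverage_sq_le`), so J is a norm limit of finite-rank operators.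

That 1 ∉ H¹₀(Ω) is shown without traces (`notMem_dirichletSpace_of_fst_ae_eq_one`). Elements of
H¹₀(Ω) may be integrated by parts against functions that do not vanish on the boundary. If 1 were
such an element, its weak derivative along the first axis would vanish, and integrating by parts
against the coordinate x₁ would give |Ω| = 0. -/

/-! ### Translation and averaging estimates in L² -/

/-- Cauchy–Schwarz against the constant function `1`, for lower Lebesgue integrals. -/
theorem sq_lintegral_le_measure_univ_mul {α : Type*} [MeasurableSpace α] (μ : Measure α)
    {f : α → ENNReal} (hf : AEMeasurable f μ) :
    (∫⁻ x, f x ∂μ) ^ 2 ≤ μ Set.univ * ∫⁻ x, f x ^ 2 ∂μ := by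
  have h := ENNReal.lintegral_mul_le_Lp_mul_Lq μ Real.HolderConjugate.two_two
    (aemeasurable_const (b := (1 : ENNReal))) hf
  simp only [Pi.mul_apply, one_mul, ENNReal.one_rpow, lintegral_one] at h
  have hhalf : ∀ a : ENNReal, (a ^ (1 / (2 : ℝ))) ^ 2 = a := fun a ↦ by
    rw [← ENNReal.rpow_natCast, ← ENNReal.rpow_mul]; norm_num
  calc (∫⁻ x, f x ∂μ) ^ 2 ≤ _ := pow_le_pow_left' h 2
    _ = _ := by simp only [mul_pow, hhalf, ENNReal.rpow_ofNat]

/-- The `L²` distance between a `C¹` function and its translate by `z` is at most `‖z‖` times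
the `L²` norm of its derivative. -/
theorem lintegral_enorm_translate_sub_sq_le {E : Type*} [NormedAddCommGroup E] [NormedSpace ℝ E]
    [FiniteDimensional ℝ E] [MeasurableSpace E] [BorelSpace E]
    (μ : Measure E) [SFinite μ] [μ.IsAddRightInvariant] {ψ : E → ℝ} (hψ : ContDiff ℝ 1 ψ) (z : E) :
    ∫⁻ x, ‖ψ (x + z) - ψ x‖ₑ ^ 2 ∂μ ≤ ‖z‖ₑ ^ 2 * ∫⁻ x, ‖fderiv ℝ ψ x‖ₑ ^ 2 ∂μ := by
  have hcont : Continuous (fderiv ℝ ψ) := hψ.continuous_fderiv one_ne_zero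
  -- Fundamental theorem of calculus on the segment from x to x + z, then Cauchy–Schwarz on (0, 1],
  -- which has measure 1.
  have hpt : ∀ x, ‖ψ (x + z) - ψ x‖ₑ ^ 2 ≤
      ∫⁻ t in Set.Ioc (0 : ℝ) 1, ‖z‖ₑ ^ 2 * ‖fderiv ℝ ψ (x + t • z)‖ₑ ^ 2 := by
    intro x
    have hline : ∀ t : ℝ, HasDerivAt (fun t : ℝ ↦ ψ (x + t • z)) (fderiv ℝ ψ (x + t • z) z) t := by
      intro t
      have h1 : HasDerivAt (fun t : ℝ ↦ x + t • z) z t := by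
        simpa using ((hasDerivAt_id t).smul_const z).const_add x
      exact ((hψ.differentiable one_ne_zero) _).hasFDerivAt.comp_hasDerivAt t h1
    have hc : Continuous fun t : ℝ ↦ fderiv ℝ ψ (x + t • z) z := by fun_prop
    have hint := intervalIntegral.integral_eq_sub_of_hasDerivAt (a := 0) (b := 1)
      (fun t _ ↦ hline t) (hc.intervalIntegrable _ _)
    simp only [one_smul, zero_smul, add_zero] at hint
    rw [intervalIntegral.integral_of_le zero_le_one] at hint
    rw [← hint]
    calc _ ≤ (∫⁻ t in Set.Ioc (0 : ℝ) 1, ‖fderiv ℝ ψ (x + t • z) z‖ₑ) ^ 2 :=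
          pow_le_pow_left' (enorm_integral_le_lintegral_enorm _) 2
      _ ≤ _ := sq_lintegral_le_measure_univ_mul _ hc.enorm.aemeasurable
      _ = ∫⁻ t in Set.Ioc (0 : ℝ) 1, ‖fderiv ℝ ψ (x + t • z) z‖ₑ ^ 2 := by simp
      _ ≤ _ := by
        refine lintegral_mono fun t ↦ ?_
        rw [← mul_pow, mul_comm]
        exact pow_le_pow_left' ((fderiv ℝ ψ (x + t • z)).le_opENorm z) 2
  calc _ ≤ ∫⁻ x, (∫⁻ t in Set.Ioc (0 : ℝ) 1, ‖z‖ₑ ^ 2 * ‖fderiv ℝ ψ (x + t • z)‖ₑ ^ 2) ∂μ :=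
        lintegral_mono hpt
    _ = ∫⁻ t in Set.Ioc (0 : ℝ) 1, ∫⁻ x, ‖z‖ₑ ^ 2 * ‖fderiv ℝ ψ (x + t • z)‖ₑ ^ 2 ∂μ := by
        refine lintegral_lintegral_swap (Measurable.aemeasurable ?_)
        have : Continuous fun p : E × ℝ ↦ fderiv ℝ ψ (p.1 + p.2 • z) := by fun_prop
        exact (this.enorm.measurable.pow_const 2).const_mul _
    _ = ∫⁻ t in Set.Ioc (0 : ℝ) 1, ‖z‖ₑ ^ 2 * ∫⁻ x, ‖fderiv ℝ ψ x‖ₑ ^ 2 ∂μ := by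
        -- After Tonelli, translation invariance removes the shift t • z, so the inner integral no
        -- longer depends on t.
        refine lintegral_congr fun t ↦ ?_
        rw [lintegral_add_right_eq_self (fun x ↦ ‖z‖ₑ ^ 2 * ‖fderiv ℝ ψ x‖ₑ ^ 2) (t • z),
          lintegral_const_mul _ (hcont.enorm.measurable.pow_const 2)]
    _ = _ := by simp

/-- The squared distance from a value of `ψ` to its mean over a set `Q` is at most the mean over
`Q` of the squared distances. -/
theorem enorm_sub_setAverage_sq_le {α : Type*} [MeasurableSpace α] {μ : Measure α} {Q : Set α}
    (h0 : μ Q ≠ 0) (htop : μ Q ≠ ⊤) {ψ : α → ℝ} (hψ : IntegrableOn ψ Q μ) (c : ℝ) :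
    ‖c - ⨍ y in Q, ψ y ∂μ‖ₑ ^ 2 ≤ (μ Q)⁻¹ * ∫⁻ y in Q, ‖ψ y - c‖ₑ ^ 2 ∂μ := by
  have hfin : IsFiniteMeasure (μ.restrict Q) := ⟨by simpa using htop.lt_top⟩
  have hr : μ.real Q ≠ 0 := (ENNReal.toReal_ne_zero.2 ⟨h0, htop⟩)
  have hkey : (c - ⨍ y in Q, ψ y ∂μ) = -((μ.real Q)⁻¹ * ∫ y in Q, (ψ y - c) ∂μ) := by
    rw [integral_sub hψ (integrable_const c), setAverage_eq, setIntegral_const, smul_eq_mul,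
      smul_eq_mul]
    field_simp
    ring
  rw [hkey, enorm_neg, enorm_mul, mul_pow]
  have h1 : ‖(μ.real Q)⁻¹‖ₑ = (μ Q)⁻¹ := by
    rw [enorm_inv hr, Real.enorm_eq_ofReal measureReal_nonneg, measureReal_def,
      ENNReal.ofReal_toReal htop]
  have h2 : ‖∫ y in Q, (ψ y - c) ∂μ‖ₑ ^ 2 ≤ μ Q * ∫⁻ y in Q, ‖ψ y - c‖ₑ ^ 2 ∂μ := by
    refine (pow_le_pow_left' (enorm_integral_le_lintegral_enorm _) 2).trans ?_
    refine (sq_lintegral_le_measure_univ_mul _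
      (hψ.sub (integrable_const c)).aestronglyMeasurable.enorm).trans ?_
    simp
  rw [h1]
  calc _ ≤ (μ Q)⁻¹ ^ 2 * (μ Q * ∫⁻ y in Q, ‖ψ y - c‖ₑ ^ 2 ∂μ) := by gcongr
    _ = (μ Q)⁻¹ * ((μ Q)⁻¹ * μ Q) * ∫⁻ y in Q, ‖ψ y - c‖ₑ ^ 2 ∂μ := by ring
    _ = _ := by rw [ENNReal.inv_mul_cancel h0 htop, mul_one]

/-! ### Approximation by averages over grid cells -/

/-- The cell with index `ν` of the grid of mesh `1 / n` in Euclidean space. -/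
def gridCell {d : ℕ} (n : ℕ) [NeZero n] (ν : Fin d → ℤ) : Set (EuclideanSpace ℝ (Fin d)) :=
  WithLp.ofLp ⁻¹' (BoxIntegral.unitPartition.box n ν : Set (Fin d → ℝ))

section gridCell

variable {d : ℕ} (n : ℕ) [NeZero n]

theorem measurableSet_gridCell (ν : Fin d → ℤ) : MeasurableSet (gridCell n ν) :=
  (PiLp.volume_preserving_ofLp (Fin d)).measurable (BoxIntegral.Box.measurableSet_coe _)

theorem volume_gridCell (ν : Fin d → ℤ) : volume (gridCell n ν) = 1 / (n : ENNReal) ^ d := by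
  rw [gridCell, (PiLp.volume_preserving_ofLp (Fin d)).measure_preimage
    (BoxIntegral.Box.measurableSet_coe _).nullMeasurableSet]
  simp

theorem mem_gridCell_iff {ν : Fin d → ℤ} {x : EuclideanSpace ℝ (Fin d)} :
    x ∈ gridCell n ν ↔ BoxIntegral.unitPartition.index n x.ofLp = ν :=
  BoxIntegral.unitPartition.mem_box_iff_index

theorem abs_sub_le_of_mem_gridCell {ν : Fin d → ℤ} {x y : EuclideanSpace ℝ (Fin d)}
    (hx : x ∈ gridCell n ν) (hy : y ∈ gridCell n ν) (i : Fin d) : |y i - x i| ≤ 1 / n := by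
  have h1 := BoxIntegral.unitPartition.mem_box_iff.1 hx i
  have h2 := BoxIntegral.unitPartition.mem_box_iff.1 hy i
  rw [add_div] at h1 h2
  rw [abs_le]
  constructor <;> linarith [h1.1, h1.2, h2.1, h2.2]

/-- A bounded set meets only finitely many grid cells. -/
theorem finite_gridCell_index {s : Set (EuclideanSpace ℝ (Fin d))} (hs : Bornology.IsBounded s) :
    {ν : Fin d → ℤ | (gridCell n ν ∩ s).Nonempty}.Finite := by
  obtain ⟨R, hR⟩ := hs.exists_norm_le
  refine (Set.finite_Icc (fun _ : Fin d ↦ -⌈(n : ℝ) * R⌉ - 1) (fun _ ↦ ⌈(n : ℝ) * R⌉)).subset ?_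
  rintro ν ⟨x, hxν, hxs⟩
  rw [Set.mem_Icc, Pi.le_def, Pi.le_def]
  have hn : (0 : ℝ) ≤ n := n.cast_nonneg
  have key : ∀ i, |(n : ℝ) * x i| ≤ ⌈(n : ℝ) * R⌉ := fun i ↦ by
    rw [abs_mul, abs_of_nonneg hn]
    have : |x i| ≤ R := (PiLp.norm_apply_le x i).trans (hR x hxs)
    exact (mul_le_mul_of_nonneg_left this hn).trans (Int.le_ceil _)
  refine ⟨fun i ↦ ?_, fun i ↦ ?_⟩ <;>
  · have h1 := BoxIntegral.unitPartition.mem_box_iff'.1 hxν i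
    have h2 := abs_le.1 (key i)
    have : ((ν i : ℤ) : ℝ) ≤ ⌈(n : ℝ) * R⌉ ∧ (-⌈(n : ℝ) * R⌉ - 1 : ℝ) ≤ ν i :=
      ⟨by linarith [h1.1, h2.2], by linarith [h1.2, h2.1]⟩
    first | exact_mod_cast this.1 | exact_mod_cast this.2

theorem norm_sq_le_of_forall_abs_le {x : EuclideanSpace ℝ (Fin d)} {r : ℝ}
    (h : ∀ i, |x i| ≤ r) : ‖x‖ ^ 2 ≤ d * r ^ 2 := by
  rw [EuclideanSpace.norm_sq_eq]
  calc ∑ i, ‖x i‖ ^ 2 ≤ ∑ _i : Fin d, r ^ 2 :=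
        Finset.sum_le_sum fun i _ ↦ pow_le_pow_left₀ (norm_nonneg _) (h i) 2
    _ = d * r ^ 2 := by simp

/-- Replacing a `C¹` function by its averages over the cells of the grid of mesh `1 / n` changes it
in `L²` by at most a multiple of `1 / n` times the `L²` norm of its derivative. -/
theorem lintegral_sub_gridAverage_sq_le {ψ : EuclideanSpace ℝ (Fin d) → ℝ} (hψ : ContDiff ℝ 1 ψ)
    (hint : Integrable ψ) :
    ∫⁻ x, ‖ψ x - ⨍ y in gridCell n (BoxIntegral.unitPartition.index n x.ofLp), ψ y‖ₑ ^ 2 ≤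
      ENNReal.ofReal (2 ^ d * d / n ^ 2) * ∫⁻ x, ‖fderiv ℝ ψ x‖ₑ ^ 2 := by
  have hn : (0 : ℝ) < n := Nat.cast_pos.2 n.pos_of_neZero
  -- B is the cube [-1/n, 1/n]ᵈ, which contains all differences of two points of one cell.
  set B : Set (EuclideanSpace ℝ (Fin d)) :=
    WithLp.ofLp ⁻¹' Set.Icc (fun _ : Fin d ↦ -(1 / n : ℝ)) (fun _ ↦ (1 / n : ℝ)) with hB
  have hBmem : ∀ z : EuclideanSpace ℝ (Fin d), z ∈ B ↔ ∀ i, |z i| ≤ 1 / n := fun z ↦ by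
    simp only [hB, Set.mem_preimage, Set.mem_Icc, Pi.le_def, abs_le, forall_and]
  have hBmeas : MeasurableSet B :=
    (PiLp.volume_preserving_ofLp (Fin d)).measurable measurableSet_Icc
  have hBvol : volume B = ENNReal.ofReal (2 / n) ^ d := by
    rw [hB, (PiLp.volume_preserving_ofLp (Fin d)).measure_preimage
      measurableSet_Icc.nullMeasurableSet, Real.volume_Icc_pi]
    simp only [Finset.prod_const, Finset.card_univ, Fintype.card_fin]
    congr 2
    ring
  have hcell : ∀ x : EuclideanSpace ℝ (Fin d),
      ‖ψ x - ⨍ y in gridCell n (BoxIntegral.unitPartition.index n x.ofLp), ψ y‖ₑ ^ 2 ≤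
      (n : ENNReal) ^ d * ∫⁻ z in B, ‖ψ (x + z) - ψ x‖ₑ ^ 2 := by
    intro x
    set Q := gridCell n (BoxIntegral.unitPartition.index n x.ofLp) with hQ
    have hxQ : x ∈ Q := (mem_gridCell_iff n).2 rfl
    have hvol : volume Q = 1 / (n : ENNReal) ^ d := volume_gridCell n _
    have hnd : (n : ENNReal) ^ d ≠ ⊤ := by finiteness
    refine (enorm_sub_setAverage_sq_le (by simp [hvol, hnd]) (by simp [hvol, NeZero.ne n])
      hint.integrableOn (ψ x)).trans ?_
    rw [hvol, one_div, inv_inv]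
    refine mul_le_mul_right ?_ _
    -- Substitute y = x + z and enlarge the domain of z to B. This makes it independent of x, so
    -- that the integrals can be swapped.
    rw [← lintegral_indicator (measurableSet_gridCell n _), ← lintegral_indicator hBmeas,
      ← lintegral_add_left_eq_self _ x]
    refine lintegral_mono fun z ↦ ?_
    by_cases hz : x + z ∈ Q
    · have hzB : z ∈ B := (hBmem z).2 fun i ↦ by
        simpa using abs_sub_le_of_mem_gridCell n hxQ hz i
      rw [Set.indicator_of_mem hz, Set.indicator_of_mem hzB]
    · rw [Set.indicator_of_notMem hz]
      exact zero_le
  have hmeas : Measurable fun p : EuclideanSpace ℝ (Fin d) × EuclideanSpace ℝ (Fin d) ↦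
      ‖ψ (p.1 + p.2) - ψ p.1‖ₑ ^ 2 := by
    have := hψ.continuous
    have h : Continuous fun p : EuclideanSpace ℝ (Fin d) × EuclideanSpace ℝ (Fin d) ↦
      ψ (p.1 + p.2) - ψ p.1 := by fun_prop
    exact h.enorm.measurable.pow_const 2
  have hshift : ∀ z ∈ B, ∫⁻ x, ‖ψ (x + z) - ψ x‖ₑ ^ 2 ≤
      ENNReal.ofReal (d * (1 / n) ^ 2) * ∫⁻ x, ‖fderiv ℝ ψ x‖ₑ ^ 2 := by
    intro z hz
    refine (lintegral_enorm_translate_sub_sq_le volume hψ z).trans ?_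
    gcongr
    rw [← ofReal_norm, ← ENNReal.ofReal_pow (norm_nonneg _)]
    exact ENNReal.ofReal_le_ofReal (norm_sq_le_of_forall_abs_le ((hBmem z).1 hz))
  calc _ ≤ ∫⁻ x, (n : ENNReal) ^ d * ∫⁻ z in B, ‖ψ (x + z) - ψ x‖ₑ ^ 2 := lintegral_mono hcell
    _ = (n : ENNReal) ^ d * ∫⁻ z in B, ∫⁻ x, ‖ψ (x + z) - ψ x‖ₑ ^ 2 := by
      rw [lintegral_const_mul _ hmeas.lintegral_prod_right',
        lintegral_lintegral_swap hmeas.aemeasurable]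
    _ ≤ (n : ENNReal) ^ d * ∫⁻ _z in B,
          ENNReal.ofReal (d * (1 / n) ^ 2) * ∫⁻ x, ‖fderiv ℝ ψ x‖ₑ ^ 2 := by
      gcongr 1
      exact setLIntegral_mono' hBmeas hshift
    -- The factors are the inverse cell volume nᵈ, the bound d / n² for ‖z‖² on B, and the volume (2
    -- / n)ᵈ of B; their product is 2ᵈ d / n².
    _ = ENNReal.ofReal (n ^ d * (d * (1 / n) ^ 2) * (2 / n) ^ d) *
          ∫⁻ x, ‖fderiv ℝ ψ x‖ₑ ^ 2 := by
      rw [setLIntegral_const, hBvol, ENNReal.ofReal_mul (p := n ^ d * _) (by positivity),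
        ENNReal.ofReal_mul (p := n ^ d) (by positivity), ENNReal.ofReal_pow hn.le,
        ENNReal.ofReal_pow (by positivity), ENNReal.ofReal_natCast]
      ring
    _ = _ := by
      congr 2
      rw [div_pow, div_pow]
      field_simp

end gridCell

/-! ### Test functions and their finite-dimensional approximation -/

section testFunctions

variable {d : ℕ} {Ω : Opens (EuclideanSpace ℝ (Fin d))}

theorem TestFunction.contDiff_one (ψ : 𝓓(Ω, ℝ)) : ContDiff ℝ 1 ψ :=
  ψ.contDiff.of_le (by exact_mod_cast le_top)

theorem TestFunction.differentiable (ψ : 𝓓(Ω, ℝ)) : Differentiable ℝ ψ :=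
  ψ.contDiff_one.differentiable one_ne_zero

theorem TestFunction.gradient_eq_comp (ψ : 𝓓(Ω, ℝ)) :
    ∇ ψ = (InnerProductSpace.toDual ℝ (EuclideanSpace ℝ (Fin d))).symm ∘ fderiv ℝ ψ := rfl

theorem TestFunction.continuous_gradient (ψ : 𝓓(Ω, ℝ)) : Continuous (∇ ψ) := by
  rw [ψ.gradient_eq_comp]
  exact (LinearIsometryEquiv.continuous _).comp (ψ.contDiff_one.continuous_fderiv one_ne_zero)

theorem TestFunction.hasCompactSupport_gradient (ψ : 𝓓(Ω, ℝ)) : HasCompactSupport (∇ ψ) := by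
  rw [ψ.gradient_eq_comp]
  exact (ψ.hasCompactSupport.fderiv ℝ).comp_left (map_zero _)

theorem TestFunction.memLp_two (ψ : 𝓓(Ω, ℝ)) :
    MemLp ψ 2 (volume.restrict (Ω : Set (EuclideanSpace ℝ (Fin d)))) :=
  ψ.continuous.memLp_of_hasCompactSupport ψ.hasCompactSupport

theorem TestFunction.memLp_two_gradient (ψ : 𝓓(Ω, ℝ)) :
    MemLp (∇ ψ) 2 (volume.restrict (Ω : Set (EuclideanSpace ℝ (Fin d)))) :=
  ψ.continuous_gradient.memLp_of_hasCompactSupport ψ.hasCompactSupport_gradient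

theorem TestFunction.eq_zero_of_notMem (ψ : 𝓓(Ω, ℝ)) {x : EuclideanSpace ℝ (Fin d)}
    (hx : x ∉ Ω) : ψ x = 0 :=
  image_eq_zero_of_notMem_tsupport fun h ↦ hx (ψ.tsupport_subset h)

theorem TestFunction.fderiv_eq_zero_of_notMem (ψ : 𝓓(Ω, ℝ)) {x : EuclideanSpace ℝ (Fin d)}
    (hx : x ∉ Ω) : fderiv ℝ ψ x = 0 := by
  by_contra h
  exact hx (ψ.tsupport_subset (support_fderiv_subset ℝ h))

theorem TestFunction.enorm_gradient (ψ : 𝓓(Ω, ℝ)) (x : EuclideanSpace ℝ (Fin d)) :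
    ‖∇ ψ x‖ₑ = ‖fderiv ℝ ψ x‖ₑ :=
  LinearIsometryEquiv.enorm_map _ _

variable (Ω) in
/-- The class of a test function in `L²(Ω)`, together with the class of its gradient. -/
noncomputable def testGraph : 𝓓(Ω, ℝ) →ₗ[ℝ]
    WithLp 2 (Lp ℝ 2 (volume.restrict (Ω : Set (EuclideanSpace ℝ (Fin d)))) ×
      Lp (EuclideanSpace ℝ (Fin d)) 2 (volume.restrict (Ω : Set (EuclideanSpace ℝ (Fin d))))) where
  toFun ψ := WithLp.toLp 2 (ψ.memLp_two.toLp ψ, ψ.memLp_two_gradient.toLp (∇ ψ))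
  map_add' ψ χ := by
    rw [← WithLp.toLp_add, Prod.mk_add_mk, ← MemLp.toLp_add, ← MemLp.toLp_add]
    congr 2
    refine MemLp.toLp_congr _ _ (Eventually.of_forall fun x ↦ ?_)
    simp only [Pi.add_apply, TestFunction.gradient_eq_comp, Function.comp_apply, ← map_add]
    rw [← fderiv_add (ψ.differentiable x) (χ.differentiable x)]
    rfl
  map_smul' c ψ := by
    rw [RingHom.id_apply, ← WithLp.toLp_smul, Prod.smul_mk, ← MemLp.toLp_const_smul,
      ← MemLp.toLp_const_smul]
    congr 2
    refine MemLp.toLp_congr _ _ (Eventually.of_forall fun x ↦ ?_)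
    simp only [Pi.smul_apply, TestFunction.gradient_eq_comp, Function.comp_apply]
    rw [← map_smul, ← fderiv_const_smul (ψ.differentiable x)]
    rfl

theorem testGraph_fst (ψ : 𝓓(Ω, ℝ)) : (testGraph Ω ψ).fst = ψ.memLp_two.toLp ψ := rfl

theorem testGraph_snd (ψ : 𝓓(Ω, ℝ)) :
    (testGraph Ω ψ).snd = ψ.memLp_two_gradient.toLp (∇ ψ) := rfl

theorem enorm_sq_eq_lintegral {α F : Type*} [MeasurableSpace α] {μ : Measure α}
    [NormedAddCommGroup F] (f : Lp F 2 μ) : ‖f‖ₑ ^ 2 = ∫⁻ x, ‖f x‖ₑ ^ 2 ∂μ := by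
  have h := eLpNorm_nnreal_pow_eq_lintegral (μ := μ) (f := f) (p := 2) two_ne_zero
  rw [Lp.enorm_def]
  simpa using h

/-- Test functions on a bounded open set can be approximated in `L²` from a finite-dimensional
space, with an error that is a small multiple of the `L²` norm of the gradient. -/
theorem exists_finiteDimensional_approx
    (hbdd : Bornology.IsBounded (Ω : Set (EuclideanSpace ℝ (Fin d)))) {ε : ℝ} (hε : 0 < ε) :
    ∃ W : Submodule ℝ (Lp ℝ 2 (volume.restrict (Ω : Set (EuclideanSpace ℝ (Fin d))))),
      FiniteDimensional ℝ W ∧ ∀ ψ : 𝓓(Ω, ℝ), ∃ s ∈ W,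
        ‖(testGraph Ω ψ).fst - s‖ ≤ ε * ‖(testGraph Ω ψ).snd‖ := by
  obtain ⟨n, hn⟩ := exists_nat_gt (2 ^ d * d / ε ^ 2)
  have hn0 : (0 : ℝ) < n := lt_of_le_of_lt (by positivity) hn
  have : NeZero n := ⟨by rintro rfl; simp at hn0⟩
  have hnε : (2 ^ d * d / n ^ 2 : ℝ) ≤ ε ^ 2 := by
    have h1 : (1 : ℝ) ≤ n := by exact_mod_cast n.pos_of_neZero
    rw [div_lt_iff₀ (by positivity)] at hn
    rw [div_le_iff₀ (by positivity)]
    nlinarith [mul_nonneg (sub_nonneg.2 h1) (mul_nonneg hn0.le (sq_nonneg ε))]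
  have hfin := finite_gridCell_index n hbdd
  have hcell : ∀ ν : Fin d → ℤ,
      (volume.restrict (Ω : Set (EuclideanSpace ℝ (Fin d)))) (gridCell n ν) ≠ ⊤ := fun ν ↦ by
    refine ((Measure.restrict_apply_le _ _).trans_lt ?_).ne
    rw [volume_gridCell, lt_top_iff_ne_top]
    simp [NeZero.ne n]
  let e : (Fin d → ℤ) → Lp ℝ 2 (volume.restrict (Ω : Set (EuclideanSpace ℝ (Fin d)))) :=
    fun ν ↦ indicatorConstLp 2 (measurableSet_gridCell n ν) (hcell ν) 1
  refine ⟨Submodule.span ℝ (e '' (hfin.toFinset : Set (Fin d → ℤ))),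
    FiniteDimensional.span_of_finite ℝ (hfin.toFinset.finite_toSet.image e), fun ψ ↦ ?_⟩
  -- The average runs over the whole cell, including any part outside Ω, where ψ is zero; this lets
  -- the estimate on all of ℝᵈ apply.
  let a : (Fin d → ℤ) → ℝ := fun ν ↦ ⨍ y in gridCell n ν, ψ y
  refine ⟨∑ ν ∈ hfin.toFinset, a ν • e ν, Submodule.sum_mem _ fun ν hν ↦
    Submodule.smul_mem _ _ (Submodule.subset_span ⟨ν, hν, rfl⟩), ?_⟩
  have hsum : ∀ᵐ x ∂(volume.restrict (Ω : Set (EuclideanSpace ℝ (Fin d)))),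
      (∑ ν ∈ hfin.toFinset, a ν • e ν : Lp ℝ 2 _) x =
        a (BoxIntegral.unitPartition.index n x.ofLp) := by
    have h1 : ∀ᵐ x ∂(volume.restrict (Ω : Set (EuclideanSpace ℝ (Fin d)))), ∀ ν,
        (a ν • e ν) x = a ν * (gridCell n ν).indicator (fun _ ↦ 1) x := by
      refine ae_all_iff.2 fun ν ↦ ?_
      filter_upwards [Lp.coeFn_smul (a ν) (e ν), indicatorConstLp_coeFn (p := 2)
        (hs := measurableSet_gridCell n ν) (hμs := hcell ν) (c := (1 : ℝ))] with x h1 h2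
      rw [h1, Pi.smul_apply, smul_eq_mul, h2]
    filter_upwards [h1, Lp.coeFn_finsetSum hfin.toFinset (fun ν ↦ a ν • e ν),
      ae_restrict_mem Ω.isOpen.measurableSet] with x hx hs hxΩ
    rw [hs, Finset.sum_apply]
    simp only [hx]
    rw [Finset.sum_eq_single (BoxIntegral.unitPartition.index n x.ofLp)]
    · rw [Set.indicator_of_mem ((mem_gridCell_iff n).2 rfl), mul_one]
    · intro ν _ hν
      rw [Set.indicator_of_notMem fun h ↦ hν ((mem_gridCell_iff n).1 h).symm, mul_zero]
    · intro h
      exact absurd (hfin.mem_toFinset.2 ⟨x, (mem_gridCell_iff n).2 rfl, hxΩ⟩) h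
  have hint : Integrable ψ :=
    ψ.continuous.integrable_of_hasCompactSupport ψ.hasCompactSupport
  have hgrad : ∫⁻ x, ‖fderiv ℝ ψ x‖ₑ ^ 2 = ‖(testGraph Ω ψ).snd‖ₑ ^ 2 := by
    rw [enorm_sq_eq_lintegral, testGraph_snd,
      ← setLIntegral_eq_of_support_subset (s := (Ω : Set (EuclideanSpace ℝ (Fin d))))]
    · refine lintegral_congr_ae ?_
      filter_upwards [ψ.memLp_two_gradient.coeFn_toLp] with x hx
      rw [hx, ψ.enorm_gradient]
    · intro x hx
      by_contra h
      refine hx ?_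
      have h0 : ∇ ψ x = 0 := by
        rw [ψ.gradient_eq_comp, Function.comp_apply, ψ.fderiv_eq_zero_of_notMem h, map_zero]
      simp only [← ψ.enorm_gradient, h0, enorm_zero, zero_pow two_ne_zero]
  have hmain : ‖(testGraph Ω ψ).fst - ∑ ν ∈ hfin.toFinset, a ν • e ν‖ₑ ^ 2 ≤
      ENNReal.ofReal (ε ^ 2) * ‖(testGraph Ω ψ).snd‖ₑ ^ 2 := by
    calc _ = ∫⁻ x in Ω, ‖ψ x - a (BoxIntegral.unitPartition.index n x.ofLp)‖ₑ ^ 2 := by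
          rw [enorm_sq_eq_lintegral]
          refine lintegral_congr_ae ?_
          filter_upwards [hsum, ψ.memLp_two.coeFn_toLp,
            Lp.coeFn_sub (testGraph Ω ψ).fst (∑ ν ∈ hfin.toFinset, a ν • e ν)] with x h1 h2 h3
          rw [h3, Pi.sub_apply, h1, testGraph_fst, h2]
      _ ≤ _ := setLIntegral_le_lintegral _ _
      _ ≤ _ := lintegral_sub_gridAverage_sq_le n ψ.contDiff_one hint
      _ ≤ _ := by
        rw [hgrad]
        gcongr
  rw [← ofReal_norm, ← ofReal_norm, ← ENNReal.ofReal_pow (norm_nonneg _),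
    ← ENNReal.ofReal_pow (norm_nonneg _), ← ENNReal.ofReal_mul (by positivity),
    ENNReal.ofReal_le_ofReal_iff (by positivity), ← mul_pow] at hmain
  exact le_of_sq_le_sq hmain (by positivity)

end testFunctions

/-! ### Compact operators and orthonormal families in Hilbert space -/

section hilbert

/-- A continuous linear map into a Hilbert space is compact if it is approximated, uniformly on
bounded subsets of a dense set, from finite-dimensional subspaces. -/
theorem isCompactOperator_of_finiteDimensional_approx {V H : Type*} [NormedAddCommGroup V]
    [InnerProductSpace ℝ V] [NormedAddCommGroup H] [InnerProductSpace ℝ H] [CompleteSpace H]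
    (J : V →L[ℝ] H) {S : Set V} (hS : Dense S)
    (h : ∀ ε : ℝ, 0 < ε → ∃ W : Submodule ℝ H, FiniteDimensional ℝ W ∧
      ∀ v ∈ S, ∃ s ∈ W, ‖J v - s‖ ≤ ε * ‖v‖) : IsCompactOperator J := by
  have happrox : J ∈ closure {f : V →L[ℝ] H | IsCompactOperator f} := by
    refine Metric.mem_closure_iff.2 fun ε hε ↦ ?_
    obtain ⟨W, hW, hWS⟩ := h (ε / 2) (by positivity)
    refine ⟨W.starProjection ∘L J, ?_, ?_⟩
    · have h1 : IsCompactOperator (W.orthogonalProjectionOnto ∘L J) :=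
        isCompactOperator_of_locallyCompactSpace_dom _
      exact h1.clm_comp W.subtypeL
    · rw [dist_eq_norm]
      refine lt_of_le_of_lt ?_ (half_lt_self hε)
      refine ContinuousLinearMap.opNorm_le_bound _ (by positivity) fun v ↦ ?_
      refine hS.induction (P := fun v ↦ ‖(J - W.starProjection ∘L J) v‖ ≤ ε / 2 * ‖v‖) ?_
        (isClosed_le (by fun_prop) (by fun_prop)) v
      intro v hv
      obtain ⟨s, hs, hsv⟩ := hWS v hv
      refine le_trans ?_ hsv
      -- The orthogonal projection is the nearest point of W, so its error is at most that of s.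
      rw [sub_apply, ContinuousLinearMap.comp_apply,
        Submodule.starProjection_minimal]
      exact ciInf_le ⟨0, by rintro _ ⟨w, rfl⟩; exact norm_nonneg _⟩ (⟨s, hs⟩ : W)
  rwa [isClosed_setOfPred_isCompactOperator.closure_eq] at happrox

/-- An orthonormal family of vectors in a separable inner product space is countable. -/
theorem Orthonormal.countable_index {ι H : Type*} [NormedAddCommGroup H] [InnerProductSpace ℝ H]
    [SeparableSpace H] {e : ι → H} (he : Orthonormal ℝ e) : Countable ι := by
  have hdisj : Pairwise fun i j ↦
      Disjoint (Metric.ball (e i) (1 / 2)) (Metric.ball (e j) (1 / 2)) := by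
    intro i j hij
    refine Metric.ball_disjoint_ball ?_
    have h : ‖e i - e j‖ ^ 2 = 2 := by
      rw [norm_sub_sq_real, he.1 i, he.1 j, he.2 hij]
      norm_num
    rw [dist_eq_norm]
    nlinarith [norm_nonneg (e i - e j)]
  exact hdisj.countable_of_isOpen_disjoint (fun _ ↦ Metric.isOpen_ball)
    fun i ↦ ⟨e i, Metric.mem_ball_self (by norm_num)⟩

/-- A compact self-adjoint operator on a Hilbert space has an orthonormal family of eigenvectors
that spans each eigenspace with nonzero eigenvalue. -/
theorem exists_orthonormal_eigenvectors {H : Type*} [NormedAddCommGroup H]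
    [InnerProductSpace ℝ H] [CompleteSpace H] {T : H →L[ℝ] H} (hT : IsCompactOperator T)
    (hsymm : T.IsSymmetric) :
    ∃ (ι : Type) (m : ι → ℝ) (e : ι → H), Orthonormal ℝ e ∧
      (∀ i, m i ≠ 0 ∧ T (e i) = m i • e i) ∧
      ∀ (μ : ℝ) (u : H), μ ≠ 0 → T u = μ • u → u ∈ Submodule.span ℝ (e '' {i | m i = μ}) := by
  have hfin : ∀ μ : {μ : ℝ // μ ≠ 0},
      FiniteDimensional ℝ (Module.End.eigenspace (T : Module.End ℝ H) μ) := fun μ ↦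
    ContinuousLinearMap.finite_dimensional_eigenspace hT μ.1 μ.2
  let b : ∀ μ : {μ : ℝ // μ ≠ 0}, OrthonormalBasis
      (Fin (Module.finrank ℝ (Module.End.eigenspace (T : Module.End ℝ H) μ))) ℝ
      (Module.End.eigenspace (T : Module.End ℝ H) μ) := fun μ ↦ stdOrthonormalBasis ℝ _
  have hfam : OrthogonalFamily ℝ
      (fun μ : {μ : ℝ // μ ≠ 0} ↦ Module.End.eigenspace (T : Module.End ℝ H) μ)
      fun μ ↦ (Module.End.eigenspace (T : Module.End ℝ H) μ.1).subtypeₗᵢ :=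
    hsymm.orthogonalFamily_eigenspaces.comp Subtype.coe_injective
  refine ⟨Σ μ : {μ : ℝ // μ ≠ 0},
      Fin (Module.finrank ℝ (Module.End.eigenspace (T : Module.End ℝ H) μ)),
    fun i ↦ i.1, fun i ↦ (b i.1 i.2 : H),
    hfam.orthonormal_sigma_orthonormal fun μ ↦ (b μ).orthonormal,
    fun i ↦ ⟨i.1.2, Module.End.mem_eigenspace_iff.1 (b i.1 i.2).2⟩, fun μ u hμ hu ↦ ?_⟩
  let w : Module.End.eigenspace (T : Module.End ℝ H) μ := ⟨u, Module.End.mem_eigenspace_iff.2 hu⟩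
  have hw := (b ⟨μ, hμ⟩).sum_repr w
  have hu' : u = ∑ i, (b ⟨μ, hμ⟩).repr w i • (b ⟨μ, hμ⟩ i : H) := by
    simpa [w] using congrArg Subtype.val hw.symm
  rw [hu']
  exact Submodule.sum_mem _ fun i _ ↦ Submodule.smul_mem _ _
    (Submodule.subset_span ⟨⟨⟨μ, hμ⟩, i⟩, rfl, rfl⟩)

/-- The eigenvectors with nonzero eigenvalues of an injective compact self-adjoint operator on a
Hilbert space have dense span. -/
theorem orthogonal_eq_bot_of_eigenvectors_mem {H : Type*} [NormedAddCommGroup H]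
    [InnerProductSpace ℝ H] [CompleteSpace H] {T : H →L[ℝ] H} (hT : IsCompactOperator T)
    (hsymm : T.IsSymmetric) (hinj : ∀ u, T u = 0 → u = 0) {K : Submodule ℝ H}
    (hK : ∀ (μ : ℝ) (u : H), μ ≠ 0 → u ≠ 0 → T u = μ • u → u ∈ K) : Kᗮ = ⊥ := by
  rw [eq_bot_iff, ← ContinuousLinearMap.orthogonalComplement_iSup_eigenspaces_eq_bot hT hsymm]
  refine Submodule.orthogonal_le (iSup_le fun μ u hu ↦ ?_)
  have hu' : T u = μ • u := Module.End.mem_eigenspace_iff.1 hu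
  by_cases hu0 : u = 0
  · exact hu0 ▸ K.zero_mem
  refine hK μ u ?_ hu0 hu'
  rintro rfl
  exact hu0 (hinj u (by simpa using hu'))

/-- If only finitely many coefficients of `f` in a complete orthonormal family are nonzero,
then `f` lies in the span of that family. -/
theorem Orthonormal.mem_span_of_finite {ι H : Type*} [NormedAddCommGroup H]
    [InnerProductSpace ℝ H] {e : ι → H} (he : Orthonormal ℝ e)
    (hK : (Submodule.span ℝ (Set.range e))ᗮ = ⊥) {f : H}
    (hf : {i | inner ℝ (e i) f ≠ 0}.Finite) : f ∈ Submodule.span ℝ (Set.range e) := by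
  classical
  set s := ∑ i ∈ hf.toFinset, inner ℝ (e i) f • e i with hs
  have hzero : f - s ∈ (Submodule.span ℝ (Set.range e))ᗮ := by
    rw [Submodule.mem_orthogonal]
    intro u hu
    induction hu using Submodule.span_induction with
    | mem u hu =>
      obtain ⟨i, rfl⟩ := hu
      rw [inner_sub_right, hs, sub_eq_zero]
      by_cases hi : i ∈ hf.toFinset
      · rw [he.inner_right_sum _ hi]
      · have h0 : inner ℝ (e i) f = 0 := by simpa using hi
        rw [h0, inner_sum]
        refine (Finset.sum_eq_zero fun j hj ↦ ?_).symm
        have hij : i ≠ j := fun h ↦ hi (h ▸ hj)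
        rw [inner_smul_right, he.2 hij, mul_zero]
    | zero => exact inner_zero_left _
    | add u v _ _ hu hv => rw [inner_add_left, hu, hv, add_zero]
    | smul c u _ hu => rw [inner_smul_left, hu, mul_zero]
  rw [hK, Submodule.mem_bot, sub_eq_zero] at hzero
  rw [hzero]
  exact Submodule.sum_mem _ fun i _ ↦ Submodule.smul_mem _ _ (Submodule.subset_span ⟨i, rfl⟩)

/-- The operator `J ∘ J†` on a Hilbert space is symmetric. -/
theorem isSymmetric_comp_adjoint {V H : Type*} [NormedAddCommGroup V] [InnerProductSpace ℝ V]
    [CompleteSpace V] [NormedAddCommGroup H] [InnerProductSpace ℝ H] [CompleteSpace H]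
    (J : V →L[ℝ] H) : (J ∘L J.adjoint).IsSymmetric := by
  intro u v
  simp only [ContinuousLinearMap.coe_coe, ContinuousLinearMap.comp_apply]
  rw [← ContinuousLinearMap.adjoint_inner_right, ContinuousLinearMap.adjoint_inner_left]

/-- This holds because ‖J†u‖² = ⟨u, J J†u⟩ = 0. It reduces injectivity of J J† to density of the
range of J. -/
theorem inner_eq_zero_of_comp_adjoint_eq_zero {V H : Type*} [NormedAddCommGroup V]
    [InnerProductSpace ℝ V] [CompleteSpace V] [NormedAddCommGroup H] [InnerProductSpace ℝ H]
    [CompleteSpace H] {J : V →L[ℝ] H} {u : H} (hu : (J ∘L J.adjoint) u = 0) (v : V) :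
    inner ℝ u (J v) = 0 := by
  have h0 : J.adjoint u = 0 := by
    rw [← inner_self_eq_zero (𝕜 := ℝ), ContinuousLinearMap.adjoint_inner_left]
    rw [ContinuousLinearMap.comp_apply] at hu
    rw [hu, inner_zero_right]
  rw [← ContinuousLinearMap.adjoint_inner_left, h0, inner_zero_left]

/-- The weak formulation of the eigenvalue equation of `J ∘ J†`. -/
theorem comp_adjoint_apply_eq_inv_smul_iff {V H : Type*} [NormedAddCommGroup V]
    [InnerProductSpace ℝ V] [CompleteSpace V] [NormedAddCommGroup H] [InnerProductSpace ℝ H]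
    [CompleteSpace H] {J : V →L[ℝ] H} {S : Set V} (hS : Dense S) {u : H} (hu : u ≠ 0) {c : ℝ} :
    (c ≠ 0 ∧ (J ∘L J.adjoint) u = c⁻¹ • u) ↔
      ∃ w, J w = u ∧ ∀ v ∈ S, inner ℝ w v = c * inner ℝ u (J v) := by
  constructor
  · rintro ⟨hc, hT⟩
    refine ⟨c • J.adjoint u, ?_, fun v _ ↦ ?_⟩
    · rw [map_smul]
      exact (eq_inv_smul_iff₀ hc).1 hT
    · rw [real_inner_smul_left, ContinuousLinearMap.adjoint_inner_left]
  · rintro ⟨w, hw, h⟩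
    -- By density the weak equation holds against every v, and this is the defining property of c •
    -- J†u.
    have hwc : w = c • J.adjoint u := by
      refine ext_inner_right ℝ fun v ↦ ?_
      rw [real_inner_smul_left, ContinuousLinearMap.adjoint_inner_left]
      exact hS.induction (P := fun v ↦ inner ℝ w v = c * inner ℝ u (J v)) h
        (isClosed_eq (by fun_prop) (by fun_prop)) v
    have hu' : u = c • (J ∘L J.adjoint) u := by
      rw [ContinuousLinearMap.comp_apply, ← map_smul, ← hwc, hw]
    have hc : c ≠ 0 := fun h0 ↦ hu (by rw [hu', h0, zero_smul])
    exact ⟨hc, by rw [eq_inv_smul_iff₀ hc, ← hu']⟩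

end hilbert

/-! ### The space H¹₀(Ω), Rellich's theorem and the resolvent -/

section dirichletSpace

variable {d : ℕ} (Ω : Opens (EuclideanSpace ℝ (Fin d)))

/-- The space `H¹₀(Ω)`, as the closed subspace of `L²(Ω) × L²(Ω; ℝᵈ)` of pairs of a function and
its weak gradient. Its inner product is the one of `H¹(Ω)`. -/
noncomputable def dirichletSpace : Submodule ℝ
    (WithLp 2 (Lp ℝ 2 (volume.restrict (Ω : Set (EuclideanSpace ℝ (Fin d)))) ×
      Lp (EuclideanSpace ℝ (Fin d)) 2 (volume.restrict (Ω : Set (EuclideanSpace ℝ (Fin d)))))) :=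
  (LinearMap.range (testGraph Ω)).topologicalClosure

instance : CompleteSpace (dirichletSpace Ω) :=
  inferInstanceAs (CompleteSpace (LinearMap.range (testGraph Ω)).topologicalClosure)

variable {Ω}

/-- In a metrizable space closure points are limits of sequences, and convergence in the product is
convergence of both components. Hilbert space methods thereby apply to the sequential definition. -/
theorem hasDirichletGradient_iff_mem
    {w : WithLp 2 (Lp ℝ 2 (volume.restrict (Ω : Set (EuclideanSpace ℝ (Fin d)))) ×
      Lp (EuclideanSpace ℝ (Fin d)) 2 (volume.restrict (Ω : Set (EuclideanSpace ℝ (Fin d)))))} :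
    HasDirichletGradient Ω w.fst w.snd ↔ w ∈ dirichletSpace Ω := by
  have hfst : ∀ ψ : ℕ → 𝓓(Ω, ℝ),
      Tendsto (fun n ↦ eLpNorm (fun x ↦ ψ n x - w.fst x) 2
        (volume.restrict (Ω : Set (EuclideanSpace ℝ (Fin d))))) atTop (𝓝 0) ↔
      Tendsto (fun n ↦ (testGraph Ω (ψ n)).fst) atTop (𝓝 w.fst) := fun ψ ↦ by
    rw [Lp.tendsto_Lp_iff_tendsto_eLpNorm']
    refine tendsto_congr fun n ↦ eLpNorm_congr_ae ?_
    filter_upwards [(ψ n).memLp_two.coeFn_toLp] with x hx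
    rw [Pi.sub_apply, testGraph_fst, hx]
  have hsnd : ∀ ψ : ℕ → 𝓓(Ω, ℝ),
      Tendsto (fun n ↦ eLpNorm (fun x ↦ ∇ (ψ n) x - w.snd x) 2
        (volume.restrict (Ω : Set (EuclideanSpace ℝ (Fin d))))) atTop (𝓝 0) ↔
      Tendsto (fun n ↦ (testGraph Ω (ψ n)).snd) atTop (𝓝 w.snd) := fun ψ ↦ by
    rw [Lp.tendsto_Lp_iff_tendsto_eLpNorm']
    refine tendsto_congr fun n ↦ eLpNorm_congr_ae ?_
    filter_upwards [(ψ n).memLp_two_gradient.coeFn_toLp] with x hx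
    rw [Pi.sub_apply, testGraph_snd, hx]
  unfold HasDirichletGradient
  simp only [hfst, hsnd]
  rw [dirichletSpace, ← SetLike.mem_coe, Submodule.topologicalClosure_coe,
    mem_closure_iff_seq_limit]
  constructor
  · rintro ⟨ψ, h1, h2⟩
    refine ⟨fun n ↦ testGraph Ω (ψ n), fun n ↦ ⟨ψ n, rfl⟩, ?_⟩
    exact ((WithLp.prod_continuous_toLp 2 _ _).tendsto (w.fst, w.snd)).comp (h1.prodMk_nhds h2)
  · rintro ⟨v, hv, hlim⟩
    choose ψ hψ using hv
    obtain rfl : (fun n ↦ testGraph Ω (ψ n)) = v := funext hψ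
    have h := ((WithLp.prod_continuous_ofLp 2 _ _).tendsto w).comp hlim
    exact ⟨ψ, (continuous_fst.tendsto _).comp h, (continuous_snd.tendsto _).comp h⟩

theorem testGraph_mem_dirichletSpace (ψ : 𝓓(Ω, ℝ)) : testGraph Ω ψ ∈ dirichletSpace Ω :=
  Submodule.le_topologicalClosure _ ⟨ψ, rfl⟩

/-- Test functions are dense in `H¹₀(Ω)`. -/
theorem dense_testGraph :
    Dense {v : dirichletSpace Ω | ∃ ψ : 𝓓(Ω, ℝ), testGraph Ω ψ = v} := by
  rw [Subtype.dense_iff]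
  intro w hw
  refine closure_mono ?_ hw
  rintro _ ⟨ψ, rfl⟩
  exact ⟨⟨_, testGraph_mem_dirichletSpace ψ⟩, ⟨ψ, rfl⟩, rfl⟩

theorem inner_toLp_eq_integral {F : Type*} [NormedAddCommGroup F] [InnerProductSpace ℝ F]
    {α : Type*} [MeasurableSpace α] {μ : Measure α} (u : Lp F 2 μ) {f : α → F} (hf : MemLp f 2 μ) :
    inner ℝ u (hf.toLp f) = ∫ x, inner ℝ (u x) (f x) ∂μ := by
  rw [L2.inner_def]
  refine integral_congr_ae ?_
  filter_upwards [hf.coeFn_toLp] with x hx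
  rw [hx]

theorem inner_testGraph_fst
    (u : Lp ℝ 2 (volume.restrict (Ω : Set (EuclideanSpace ℝ (Fin d))))) (ψ : 𝓓(Ω, ℝ)) :
    inner ℝ u (testGraph Ω ψ).fst = ∫ x in Ω, u x * ψ x := by
  rw [testGraph_fst, inner_toLp_eq_integral]
  simp only [RCLike.inner_apply, conj_trivial, mul_comm]

theorem inner_testGraph
    (w : WithLp 2 (Lp ℝ 2 (volume.restrict (Ω : Set (EuclideanSpace ℝ (Fin d)))) ×
      Lp (EuclideanSpace ℝ (Fin d)) 2 (volume.restrict (Ω : Set (EuclideanSpace ℝ (Fin d))))))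
    (ψ : 𝓓(Ω, ℝ)) :
    inner ℝ w (testGraph Ω ψ) =
      (∫ x in Ω, w.fst x * ψ x) + ∫ x in Ω, inner ℝ (w.snd x) (∇ ψ x) := by
  rw [WithLp.prod_inner_apply]
  change inner ℝ w.fst (testGraph Ω ψ).fst + inner ℝ w.snd (testGraph Ω ψ).snd = _
  rw [inner_testGraph_fst, testGraph_snd, inner_toLp_eq_integral]

/-- A square-integrable function on `Ω` that is orthogonal to all test functions vanishes. -/
theorem ae_eq_zero_of_forall_testFunction {f : EuclideanSpace ℝ (Fin d) → ℝ}
    (hf : MemLp f 2 (volume.restrict (Ω : Set (EuclideanSpace ℝ (Fin d)))))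
    (h : ∀ ψ : 𝓓(Ω, ℝ), ∫ x in Ω, f x * ψ x = 0) :
    ∀ᵐ x ∂(volume.restrict (Ω : Set (EuclideanSpace ℝ (Fin d)))), f x = 0 := by
  rw [ae_restrict_iff' Ω.isOpen.measurableSet]
  refine Ω.isOpen.ae_eq_zero_of_integral_contDiff_smul_eq_zero ?_ fun g hg hgc hgΩ ↦ ?_
  · exact locallyIntegrableOn_of_locallyIntegrable_restrict (hf.locallyIntegrable one_le_two)
  · let ψ : 𝓓(Ω, ℝ) := ⟨g, hg, hgc, hgΩ⟩
    rw [← h ψ, ← setIntegral_eq_integral_of_forall_compl_eq_zero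
      (s := (Ω : Set (EuclideanSpace ℝ (Fin d))))]
    · exact integral_congr_ae (Eventually.of_forall fun x ↦ mul_comm _ _)
    · intro x hx
      have : g x = 0 := ψ.eq_zero_of_notMem hx
      rw [this, zero_smul]

variable (Ω) in
/-- The inclusion of `H¹₀(Ω)` into `L²(Ω)`. -/
noncomputable def dirichletInclusion : dirichletSpace Ω →L[ℝ]
    Lp ℝ 2 (volume.restrict (Ω : Set (EuclideanSpace ℝ (Fin d)))) :=
  WithLp.fstL 2 ℝ _ _ ∘L (dirichletSpace Ω).subtypeL

theorem dirichletInclusion_apply (w : dirichletSpace Ω) :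
    dirichletInclusion Ω w = w.1.fst := rfl

theorem dirichletSpace_inner_def (v w : dirichletSpace Ω) :
    inner ℝ v w = inner ℝ v.1 w.1 := rfl

theorem dirichletSpace_norm_def (v : dirichletSpace Ω) : ‖v‖ = ‖v.1‖ := rfl

theorem exists_finiteDimensional_approx_dirichletInclusion
    (hbdd : Bornology.IsBounded (Ω : Set (EuclideanSpace ℝ (Fin d)))) {ε : ℝ} (hε : 0 < ε) :
    ∃ W : Submodule ℝ (Lp ℝ 2 (volume.restrict (Ω : Set (EuclideanSpace ℝ (Fin d))))),
      FiniteDimensional ℝ W ∧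
      ∀ v ∈ {v : dirichletSpace Ω | ∃ ψ : 𝓓(Ω, ℝ), testGraph Ω ψ = v}, ∃ s ∈ W,
        ‖dirichletInclusion Ω v - s‖ ≤ ε * ‖v‖ := by
  obtain ⟨W, hW, h⟩ := exists_finiteDimensional_approx hbdd hε
  refine ⟨W, hW, ?_⟩
  rintro v ⟨ψ, hψ⟩
  obtain ⟨s, hs, hsψ⟩ := h ψ
  refine ⟨s, hs, ?_⟩
  rw [dirichletInclusion_apply, ← hψ]
  refine hsψ.trans (mul_le_mul_of_nonneg_left ?_ hε.le)
  calc ‖(testGraph Ω ψ).snd‖ ≤ ‖testGraph Ω ψ‖ := WithLp.norm_snd_le _ _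
    _ = ‖v‖ := by rw [hψ, dirichletSpace_norm_def]

/-- **Rellich's theorem**: for bounded `Ω`, the inclusion of `H¹₀(Ω)` into `L²(Ω)` is compact. -/
theorem isCompactOperator_dirichletInclusion
    (hbdd : Bornology.IsBounded (Ω : Set (EuclideanSpace ℝ (Fin d)))) :
    IsCompactOperator (dirichletInclusion Ω) :=
  isCompactOperator_of_finiteDimensional_approx (dirichletInclusion Ω) dense_testGraph
    fun _ hε ↦ exists_finiteDimensional_approx_dirichletInclusion hbdd hε

variable (Ω) in
/-- The operator `(1 - Δ)⁻¹` on `L²(Ω)` with Dirichlet boundary conditions. -/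
noncomputable def dirichletResolvent :
    Lp ℝ 2 (volume.restrict (Ω : Set (EuclideanSpace ℝ (Fin d)))) →L[ℝ]
      Lp ℝ 2 (volume.restrict (Ω : Set (EuclideanSpace ℝ (Fin d)))) :=
  dirichletInclusion Ω ∘L (dirichletInclusion Ω).adjoint

theorem isCompactOperator_dirichletResolvent
    (hbdd : Bornology.IsBounded (Ω : Set (EuclideanSpace ℝ (Fin d)))) :
    IsCompactOperator (dirichletResolvent Ω) :=
  (isCompactOperator_dirichletInclusion hbdd).comp_clm _

theorem isSymmetric_dirichletResolvent : (dirichletResolvent Ω).IsSymmetric :=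
  isSymmetric_comp_adjoint _

/-- The kernel of J J† is orthogonal to the range of J, which contains every test function. -/
theorem eq_zero_of_dirichletResolvent_eq_zero
    (u : Lp ℝ 2 (volume.restrict (Ω : Set (EuclideanSpace ℝ (Fin d)))))
    (hu : dirichletResolvent Ω u = 0) : u = 0 := by
  have hae := ae_eq_zero_of_forall_testFunction (Lp.memLp u) fun ψ ↦ by
    rw [← inner_testGraph_fst]
    exact inner_eq_zero_of_comp_adjoint_eq_zero hu ⟨_, testGraph_mem_dirichletSpace ψ⟩
  exact (Lp.eq_zero_iff_ae_eq_zero).2 hae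

/-- The Dirichlet eigenfunctions with eigenvalue `ev` are the eigenvectors of the resolvent with
eigenvalue `(1 + ev)⁻¹`. -/
theorem isDirichletEigenfunction_iff {ev : ℝ}
    {u : Lp ℝ 2 (volume.restrict (Ω : Set (EuclideanSpace ℝ (Fin d))))} :
    IsDirichletEigenfunction Ω ev u ↔
      u ≠ 0 ∧ 1 + ev ≠ 0 ∧ dirichletResolvent Ω u = (1 + ev)⁻¹ • u := by
  refine and_congr_right fun hu ↦ ?_
  rw [dirichletResolvent, comp_adjoint_apply_eq_inv_smul_iff dense_testGraph hu]
  constructor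
  · rintro ⟨g, hg, h⟩
    -- The H¹ inner product adds ∫ u ψ to the gradient term, which shifts the eigenvalue from `ev`
    -- to 1 + `ev`.
    refine ⟨⟨WithLp.toLp 2 (u, g), hasDirichletGradient_iff_mem.1 hg⟩, rfl, ?_⟩
    rintro v ⟨ψ, hψ⟩
    rw [dirichletInclusion_apply, dirichletSpace_inner_def, ← hψ, inner_testGraph,
      inner_testGraph_fst]
    change (∫ x in Ω, u x * ψ x) + ∫ x in Ω, inner ℝ (g x) (∇ ψ x) = _
    rw [h ψ]
    ring
  · rintro ⟨w, rfl, h⟩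
    refine ⟨w.1.snd, hasDirichletGradient_iff_mem.2 w.2, fun ψ ↦ ?_⟩
    have h1 : inner ℝ w.1 (testGraph Ω ψ) = (1 + ev) * inner ℝ w.1.fst (testGraph Ω ψ).fst :=
      h ⟨_, testGraph_mem_dirichletSpace ψ⟩ ⟨ψ, rfl⟩
    rw [inner_testGraph, inner_testGraph_fst] at h1
    rw [dirichletInclusion_apply]
    linarith

end dirichletSpace

/-! ### Constants are not in H¹₀(Ω) -/

section constants

variable {d : ℕ} {Ω : Opens (EuclideanSpace ℝ (Fin d))}

theorem isFiniteMeasure_restrict_of_isBounded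
    (hbdd : Bornology.IsBounded (Ω : Set (EuclideanSpace ℝ (Fin d)))) :
    IsFiniteMeasure (volume.restrict (Ω : Set (EuclideanSpace ℝ (Fin d)))) :=
  isFiniteMeasure_restrict.2 hbdd.measure_lt_top.ne

theorem Continuous.memLp_restrict_of_isBounded {F : Type*} [NormedAddCommGroup F]
    {f : EuclideanSpace ℝ (Fin d) → F} (hf : Continuous f)
    (hbdd : Bornology.IsBounded (Ω : Set (EuclideanSpace ℝ (Fin d)))) :
    MemLp f 2 (volume.restrict (Ω : Set (EuclideanSpace ℝ (Fin d)))) := by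
  have := isFiniteMeasure_restrict_of_isBounded hbdd
  obtain ⟨C, hC⟩ := hbdd.isCompact_closure.exists_bound_of_continuousOn hf.continuousOn
  have := secondCountableTopologyEither_of_left (EuclideanSpace ℝ (Fin d)) F
  refine MemLp.of_bound hf.aestronglyMeasurable C ?_
  filter_upwards [ae_restrict_mem Ω.isOpen.measurableSet] with x hx
  exact hC x (subset_closure hx)

/-- Integration by parts against a test function. -/
theorem TestFunction.setIntegral_mul_fderiv (ψ : 𝓓(Ω, ℝ)) {η : EuclideanSpace ℝ (Fin d) → ℝ}
    (hη : ContDiff ℝ 1 η) (v : EuclideanSpace ℝ (Fin d)) :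
    (∫ x in Ω, fderiv ℝ η x v * ψ x) + ∫ x in Ω, η x * fderiv ℝ ψ x v = 0 := by
  have hψ' : Continuous fun x ↦ fderiv ℝ ψ x v :=
    (ψ.contDiff_one.continuous_fderiv one_ne_zero).clm_apply continuous_const
  have hη' : Continuous fun x ↦ fderiv ℝ η x v :=
    (hη.continuous_fderiv one_ne_zero).clm_apply continuous_const
  have hc : HasCompactSupport fun x ↦ fderiv ℝ ψ x v := ψ.hasCompactSupport.fderiv_apply ℝ v
  rw [setIntegral_eq_integral_of_forall_compl_eq_zero,
    setIntegral_eq_integral_of_forall_compl_eq_zero,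
    integral_mul_fderiv_eq_neg_fderiv_mul_of_integrable, add_neg_cancel]
  · exact (hη'.mul ψ.continuous).integrable_of_hasCompactSupport ψ.hasCompactSupport.mul_left
  · exact (hη.continuous.mul hψ').integrable_of_hasCompactSupport hc.mul_left
  · exact (hη.continuous.mul ψ.continuous).integrable_of_hasCompactSupport
      ψ.hasCompactSupport.mul_left
  · exact fun x _ ↦ hη.differentiable one_ne_zero x
  · exact fun x _ ↦ ψ.differentiable x
  · intro x hx
    rw [ψ.fderiv_eq_zero_of_notMem hx, zero_apply, mul_zero]
  · intro x hx
    rw [ψ.eq_zero_of_notMem hx, mul_zero]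

/-- Integration by parts for a function in `H¹₀(Ω)` against a function that need not vanish on the
boundary. -/
theorem setIntegral_mul_fderiv_of_mem_dirichletSpace
    (hbdd : Bornology.IsBounded (Ω : Set (EuclideanSpace ℝ (Fin d))))
    {w : WithLp 2 (Lp ℝ 2 (volume.restrict (Ω : Set (EuclideanSpace ℝ (Fin d)))) ×
      Lp (EuclideanSpace ℝ (Fin d)) 2 (volume.restrict (Ω : Set (EuclideanSpace ℝ (Fin d)))))}
    (hw : w ∈ dirichletSpace Ω) {η : EuclideanSpace ℝ (Fin d) → ℝ} (hη : ContDiff ℝ 1 η)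
    (v : EuclideanSpace ℝ (Fin d)) :
    (∫ x in Ω, w.fst x * fderiv ℝ η x v) + ∫ x in Ω, inner ℝ (w.snd x) (η x • v) = 0 := by
  have h1 : MemLp (fun x ↦ fderiv ℝ η x v) 2
      (volume.restrict (Ω : Set (EuclideanSpace ℝ (Fin d)))) :=
    ((hη.continuous_fderiv one_ne_zero).clm_apply
      continuous_const).memLp_restrict_of_isBounded hbdd
  have h2 : MemLp (fun x ↦ η x • v) 2 (volume.restrict (Ω : Set (EuclideanSpace ℝ (Fin d)))) :=
    (hη.continuous.smul continuous_const).memLp_restrict_of_isBounded hbdd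
  have hin : ∀ w : WithLp 2 (Lp ℝ 2 (volume.restrict (Ω : Set (EuclideanSpace ℝ (Fin d)))) ×
      Lp (EuclideanSpace ℝ (Fin d)) 2 (volume.restrict (Ω : Set (EuclideanSpace ℝ (Fin d))))),
      inner ℝ w.fst (h1.toLp _) + inner ℝ w.snd (h2.toLp _) =
      (∫ x in Ω, w.fst x * fderiv ℝ η x v) + ∫ x in Ω, inner ℝ (w.snd x) (η x • v) := fun w ↦ by
    rw [inner_toLp_eq_integral, inner_toLp_eq_integral]
    simp only [RCLike.inner_apply, conj_trivial, mul_comm]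
  rw [← hin]
  -- The identity is a closed condition on w, so it passes from test functions to their closure.
  have hclosed : IsClosed {w : WithLp 2 (Lp ℝ 2 (volume.restrict
      (Ω : Set (EuclideanSpace ℝ (Fin d)))) × Lp (EuclideanSpace ℝ (Fin d)) 2
      (volume.restrict (Ω : Set (EuclideanSpace ℝ (Fin d))))) |
      inner ℝ w.fst (h1.toLp _) + inner ℝ w.snd (h2.toLp _) = 0} :=
    isClosed_eq (by fun_prop) continuous_const
  refine hclosed.closure_subset_iff.2 ?_ hw
  rintro _ ⟨ψ, rfl⟩
  rw [Set.mem_ofPred_eq, hin, ← ψ.setIntegral_mul_fderiv hη v]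
  congr 1
  · refine integral_congr_ae ?_
    filter_upwards [ψ.memLp_two.coeFn_toLp] with x hx
    rw [testGraph_fst, hx, mul_comm]
  · refine integral_congr_ae ?_
    filter_upwards [ψ.memLp_two_gradient.coeFn_toLp] with x hx
    rw [testGraph_snd, hx, inner_smul_right, inner_gradient_left]

/-- A nonzero constant function on a bounded nonempty open set does not belong to `H¹₀`. -/
theorem notMem_dirichletSpace_of_fst_ae_eq_one (hd : 0 < d)
    (hne : (Ω : Set (EuclideanSpace ℝ (Fin d))).Nonempty)
    (hbdd : Bornology.IsBounded (Ω : Set (EuclideanSpace ℝ (Fin d))))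
    {w : WithLp 2 (Lp ℝ 2 (volume.restrict (Ω : Set (EuclideanSpace ℝ (Fin d)))) ×
      Lp (EuclideanSpace ℝ (Fin d)) 2 (volume.restrict (Ω : Set (EuclideanSpace ℝ (Fin d)))))}
    (hone : ∀ᵐ x ∂(volume.restrict (Ω : Set (EuclideanSpace ℝ (Fin d)))), w.fst x = 1) :
    w ∉ dirichletSpace Ω := by
  intro hw
  -- A unit coordinate vector; it exists because d > 0.
  let v : EuclideanSpace ℝ (Fin d) := EuclideanSpace.single ⟨0, hd⟩ 1
  have hv : inner ℝ v v = 1 := by simp [v]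
  have hparts : ∀ {η : EuclideanSpace ℝ (Fin d) → ℝ}, ContDiff ℝ 1 η →
      (∫ x in Ω, fderiv ℝ η x v) + ∫ x in Ω, inner ℝ (w.snd x) v * η x = 0 := fun {η} hη ↦ by
    rw [← setIntegral_mul_fderiv_of_mem_dirichletSpace hbdd hw hη v]
    congr 1
    · refine integral_congr_ae ?_
      filter_upwards [hone] with x hx
      rw [hx, one_mul]
    · simp only [inner_smul_right, mul_comm]
  -- Take η = ψ, a test function: ∫ ∂ᵥψ = 0, so the component of the weak gradient along v is
  -- orthogonal to all test functions.
  have hzero : ∀ᵐ x ∂(volume.restrict (Ω : Set (EuclideanSpace ℝ (Fin d)))),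
      inner ℝ (w.snd x) v = 0 := by
    refine ae_eq_zero_of_forall_testFunction ((Lp.memLp w.snd).inner_const v) fun ψ ↦ ?_
    have h1 := hparts ψ.contDiff_one
    have h2 := ψ.setIntegral_mul_fderiv (η := fun _ ↦ 1) contDiff_const v
    simp only [fderiv_fun_const, Pi.zero_apply, zero_apply, zero_mul, integral_zero, one_mul,
      zero_add] at h2
    rwa [h2, zero_add] at h1
  -- Now η(x) = ⟨v, x⟩ has ∂ᵥη = 1, and the identity collapses to |Ω| = 0.
  have h := hparts (η := fun x ↦ innerSL ℝ v x) (innerSL ℝ v).contDiff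
  have h1 : ∀ x, fderiv ℝ (fun x ↦ innerSL ℝ v x) x v = 1 := fun x ↦ by
    rw [ContinuousLinearMap.fderiv]
    exact hv
  have h2 : ∫ x in Ω, inner ℝ (w.snd x) v * innerSL ℝ v x = 0 := by
    rw [← integral_zero (EuclideanSpace ℝ (Fin d)) ℝ
      (μ := volume.restrict (Ω : Set (EuclideanSpace ℝ (Fin d))))]
    refine integral_congr_ae ?_
    filter_upwards [hzero] with x hx
    rw [hx, zero_mul]
  simp only [h1] at h
  rw [h2, add_zero, setIntegral_const, smul_eq_mul, mul_one] at h
  have hpos : 0 < volume.real (Ω : Set (EuclideanSpace ℝ (Fin d))) :=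
    ENNReal.toReal_pos (Ω.isOpen.measure_pos volume hne).ne' hbdd.measure_lt_top.ne
  exact hpos.ne' h

end constants

/-! ### Eigensequences and their mean values -/

section eigensequence

variable {d : ℕ} {Ω : Opens (EuclideanSpace ℝ (Fin d))}

theorem IsDirichletEigenfunction.mem_range {ev : ℝ}
    {u : Lp ℝ 2 (volume.restrict (Ω : Set (EuclideanSpace ℝ (Fin d))))}
    (hu : IsDirichletEigenfunction Ω ev u) :
    u ∈ LinearMap.range (dirichletInclusion Ω).toLinearMap := by
  obtain ⟨-, g, hg, -⟩ := hu
  exact ⟨⟨WithLp.toLp 2 (u, g), hasDirichletGradient_iff_mem.1 hg⟩, rfl⟩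

/-- A complete orthonormal family of Dirichlet eigenfunctions has infinitely many members with
nonzero integral. -/
theorem infinite_setOf_setIntegral_ne_zero (hd : 0 < d)
    (hne : (Ω : Set (EuclideanSpace ℝ (Fin d))).Nonempty)
    (hbdd : Bornology.IsBounded (Ω : Set (EuclideanSpace ℝ (Fin d)))) {ι : Type*}
    {e : ι → Lp ℝ 2 (volume.restrict (Ω : Set (EuclideanSpace ℝ (Fin d))))}
    (he : Orthonormal ℝ e) (heig : ∀ i, ∃ ev, IsDirichletEigenfunction Ω ev (e i))
    (hall : ∀ ev u, IsDirichletEigenfunction Ω ev u → u ∈ Submodule.span ℝ (Set.range e)) :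
    {i | ∫ x in Ω, e i x ≠ 0}.Infinite := by
  intro hfin
  have hone : MemLp (fun _ ↦ (1 : ℝ)) 2 (volume.restrict (Ω : Set (EuclideanSpace ℝ (Fin d)))) :=
    continuous_const.memLp_restrict_of_isBounded hbdd
  have hinner : ∀ i, inner ℝ (e i) (hone.toLp _) = ∫ x in Ω, e i x := fun i ↦ by
    rw [inner_toLp_eq_integral]
    simp
  have hK : (Submodule.span ℝ (Set.range e))ᗮ = ⊥ := by
    refine orthogonal_eq_bot_of_eigenvectors_mem (isCompactOperator_dirichletResolvent hbdd)
      isSymmetric_dirichletResolvent eq_zero_of_dirichletResolvent_eq_zero fun μ u hμ hu hT ↦ ?_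
    -- Solving μ = (1 + λ)⁻¹ for λ.
    refine hall (μ⁻¹ - 1) u (isDirichletEigenfunction_iff.2 ⟨hu, ?_, ?_⟩)
    · simpa using hμ
    · simpa using hT
  have hmem := he.mem_span_of_finite hK (f := hone.toLp _) (by simpa only [hinner] using hfin)
  have hle : Submodule.span ℝ (Set.range e) ≤
      LinearMap.range (dirichletInclusion Ω).toLinearMap := by
    rw [Submodule.span_le]
    rintro _ ⟨i, rfl⟩
    exact (heig i).choose_spec.mem_range
  obtain ⟨w, hw⟩ := hle hmem
  refine notMem_dirichletSpace_of_fst_ae_eq_one hd hne hbdd (w := w.1) ?_ w.2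
  have hw' : w.1.fst = hone.toLp _ := hw
  rw [hw']
  exact hone.coeFn_toLp

/-- The spectral theorem gives an orthonormal family over some index type. It is countable because
L²(Ω) is separable, and infinite because infinitely many members have nonzero integral, so it can be
reindexed by ℕ. -/
theorem exists_isDirichletEigensequence (hd : 0 < d)
    (hne : (Ω : Set (EuclideanSpace ℝ (Fin d))).Nonempty)
    (hbdd : Bornology.IsBounded (Ω : Set (EuclideanSpace ℝ (Fin d)))) :
    ∃ (ev : ℕ → ℝ) (φ : ℕ → Lp ℝ 2 (volume.restrict (Ω : Set (EuclideanSpace ℝ (Fin d))))),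
      IsDirichletEigensequence Ω ev φ := by
  obtain ⟨ι, m, e, he, heig, hall⟩ := exists_orthonormal_eigenvectors
    (isCompactOperator_dirichletResolvent hbdd) isSymmetric_dirichletResolvent
  have heig' : ∀ i, IsDirichletEigenfunction Ω ((m i)⁻¹ - 1) (e i) := fun i ↦
    isDirichletEigenfunction_iff.2 ⟨he.ne_zero i, by simpa using (heig i).1,
      by simpa using (heig i).2⟩
  have hall' : ∀ ev u, IsDirichletEigenfunction Ω ev u →
      u ∈ Submodule.span ℝ (e '' {i | (m i)⁻¹ - 1 = ev}) := fun ev u hu ↦ by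
    obtain ⟨-, hev, hT⟩ := isDirichletEigenfunction_iff.1 hu
    refine Submodule.span_mono (Set.image_mono ?_) (hall _ u (inv_ne_zero hev) hT)
    intro i hi
    rw [Set.mem_ofPred_eq] at hi ⊢
    rw [hi, inv_inv, add_sub_cancel_left]
  have : Fact ((2 : ENNReal) ≠ ⊤) := ⟨ENNReal.ofNat_ne_top⟩
  have hcount : Countable ι := he.countable_index
  have hinf : Infinite ι := by
    have h := infinite_setOf_setIntegral_ne_zero hd hne hbdd he (fun i ↦ ⟨_, heig' i⟩)
      fun ev u hu ↦ Submodule.span_mono (Set.image_subset_range _ _) (hall' ev u hu)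
    exact Set.infinite_univ_iff.1 (h.mono (Set.subset_univ _))
  obtain ⟨f⟩ := nonempty_equiv_of_countable (α := ℕ) (β := ι)
  refine ⟨fun k ↦ (m (f k))⁻¹ - 1, e ∘ f, he.comp f f.injective, fun k ↦ heig' (f k),
    fun μ u hu ↦ Submodule.span_mono ?_ (hall' μ u hu)⟩
  rintro _ ⟨i, hi, rfl⟩
  refine ⟨f.symm i, ?_, by simp⟩
  simpa using hi

end eigensequence

theorem mainTheorem2 {d : ℕ} (hd : 0 < d) (Ω : Opens (EuclideanSpace ℝ (Fin d)))
    (hconn : IsConnected (Ω : Set (EuclideanSpace ℝ (Fin d))))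
    (hbdd : Bornology.IsBounded (Ω : Set (EuclideanSpace ℝ (Fin d)))) :
    (∃ (ev : ℕ → ℝ) (φ : ℕ → Lp ℝ 2 (volume.restrict (Ω : Set (EuclideanSpace ℝ (Fin d))))),
      IsDirichletEigensequence Ω ev φ) ∧
    ∀ (ev : ℕ → ℝ) (φ : ℕ → Lp ℝ 2 (volume.restrict (Ω : Set (EuclideanSpace ℝ (Fin d))))),
      IsDirichletEigensequence Ω ev φ → {k : ℕ | ⨍ x in Ω, φ k x ≠ 0}.Infinite := by
  refine ⟨exists_isDirichletEigensequence hd hconn.nonempty hbdd, fun ev φ h ↦ ?_⟩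
  refine (infinite_setOf_setIntegral_ne_zero hd hconn.nonempty hbdd h.orthonormal
    (fun k ↦ ⟨_, h.eigenfunction k⟩) fun μ u hu ↦
      Submodule.span_mono (Set.image_subset_range _ _) (h.exhaustive μ u hu)).mono fun k hk ↦ ?_
  -- The mean is the integral divided by |Ω|, and |Ω| is positive and finite, so the two vanish
  -- together.
  have hpos : 0 < volume.real (Ω : Set (EuclideanSpace ℝ (Fin d))) :=
    ENNReal.toReal_pos (Ω.isOpen.measure_pos volume hconn.nonempty).ne' hbdd.measure_lt_top.ne
  rw [Set.mem_ofPred_eq] at hk ⊢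
  rw [setAverage_eq]
  exact smul_ne_zero (inv_ne_zero hpos.ne') hk
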